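/- A polygonal domain $P$ (a polygon, possibly with holes) is a compact connected region of the plane that is the closure of its interior and whose boundary is a finite disjoint union of simple polygons; let $n$ be its total number of vertices. For $\alpha\ge 0$ its edge-inflation $P_\alpha$ is obtained by shifting each edge outwards by $\alpha$, orthogonally to itself: $P_\alpha$ is the union of $P$, of the rectangles swept by the shifted edges, and, at each convex vertex, of the kite between the two outward normals and the two shifted edges, extended until they meet (parts that grow into each other are merged). For $s,t\in P$, let $\chi[\alpha]$ be the set of all polygonal paths $s,v_1,\dots,v_{k-1},t$, $k\ge 1$, all of whose $k$ links lie in $P_\alpha$. The path is a minimum-link path if $k$ is minimum. For an integer $z$ let $\mathrm{BIT}(z)$ be the length of the binary representation of $|z|$, and for a reduced fraction let $\mathrm{BIT}(p/q)=\mathrm{BIT}(p)+\mathrm{BIT}(q)$. The input bit length of a list of rational points is the maximum of $\mathrm{BIT}$ over their coordinates ($0$ for the empty list). Let $\mathrm{BIT}(\chi[\alpha])\in\mathbb N\cup\{\infty\}$ be the minimum input bit length of the list of bends $(v_1,\dots,v_{k-1})$ over all minimum-link paths in $\chi[\alpha]$ with rational bends. For a real RAM program $A$ (with any word size) that is given $P,s,t,\alpha$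 and the bends, let $\mathrm{BIT}_A(\chi[\alpha])$ be the minimum, over all minimum-link paths $v$ in $\chi[\alpha]$, of the input bit complexity $\mathrm{BIT}_{IN}(v,A)$, that is, of the least input bit length of a list $v'$ of equally many rational bends on which all comparisons of $A$ have the same results as on $v$. (If $A$ accepts exactly the paths in $\chi[\alpha]$, the two quantities agree.) Theorem. There is an absolute constant $C>0$ such that for every polygonal domain $P$ with $n$ vertices, all $s,t\in P$, all $\delta\in(0,1]$ and all $L\ge 1$ with $P_\delta\subseteq[-L,L]^2$, the function $\alpha\mapsto \mathrm{BIT}(\chi[\alpha])$ is measurable and, for $\alpha$ uniformly distributed in $[0,\delta]$, $$\mathbb E_\alpha\big[\mathrm{BIT}(\chi[\alpha])\big]\le C\log\frac{nL}{\delta},$$ and the same bound holds for $\mathrm{BIT}_A(\chi[\alpha])$, for every real RAM program $A$ and every word size. In particular, if coordinates are normalised ($L=1$), the expected input bit complexity of a minimum-link path is $O(\log(n/\delta))$. -/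

import Mathlib

open scoped ENNReal Topology ProbabilityTheory

noncomputable section

namespace MinLink

/-! ### Polygonal domains -/

/-- The Euclidean plane. -/
abbrev Plane : Type := EuclideanSpace ℝ (Fin 2)

/-- A closed polygon `v 0, …, v (n-1)` is simple: it has at least three vertices, its edges
`[v i, v (i+1)]` are nondegenerate, and two different edges meet at most in the end point that
consecutive edges share. -/
def IsSimple {n : ℕ} (p : Polygon Plane n) : Prop :=
  3 ≤ n ∧ p.HasNondegenerateEdges ∧
    ∀ i k : Fin n, i ≠ k → ∀ x ∈ p.edgeSet ℝ i ∩ p.edgeSet ℝ k,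
      (k = finRotate n i ∧ x = p k) ∨ (i = finRotate n k ∧ x = p i)

/-- A polygonal domain (a polygon, possibly with holes): a compact connected region of the plane
that is the closure of its interior and whose boundary is the union of finitely many pairwise
disjoint simple polygons. -/
structure PolygonalDomain where
  /-- number of boundary polygons (the outer boundary and the holes) -/
  numCycles : ℕ
  /-- number of vertices of each boundary polygon -/
  size : Fin numCycles → ℕ
  /-- the boundary polygons -/
  cycle : (j : Fin numCycles) → Polygon Plane (size j)
  /-- the closed region that they bound -/
  region : Set Plane
  simple : ∀ j, IsSimple (cycle j)
  disjoint : ∀ j k, j ≠ k → Disjoint ((cycle j).boundary ℝ) ((cycle k).boundary ℝ)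
  isCompact : IsCompact region
  isConnected : IsConnected region
  closure_interior : closure (interior region) = region
  frontier_eq : frontier region = ⋃ j, (cycle j).boundary ℝ

namespace PolygonalDomain

variable (D : PolygonalDomain)

/-- The total number `n` of vertices (equivalently, of edges). -/
def numVertices : ℕ := ∑ j, D.size j

/-- The pairs `(a, b)` such that `[a, b]` is an edge of the domain. -/
def IsEdge (a b : Plane) : Prop :=
  ∃ (j : Fin D.numCycles) (i : Fin (D.size j)),
    a = D.cycle j i ∧ b = D.cycle j (finRotate (D.size j) i)

/-- `ν` is the outward unit normal of the edge `[a, b]`: a unit vector orthogonal to the edge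
that points out of the region. (For an edge of a polygonal domain one of the two sides of the
relative interior lies inside and the other one outside, the same at all of its points.) -/
def IsOutwardNormal (a b ν : Plane) : Prop :=
  ‖ν‖ = 1 ∧ inner ℝ ν (b - a) = 0 ∧
    ∃ x ∈ openSegment ℝ a b, ∀ᶠ r in 𝓝[>] (0 : ℝ), x + r • ν ∉ D.region

/-- What the edges sweep when each of them is shifted outwards by `α`, in the direction orthogonal
to it: the union of the rectangles with sides `[a, b]` and `[a + α ν, b + α ν]`. -/
def sweep (α : ℝ) : Set Plane :=
  {y | ∃ a b ν : Plane, D.IsEdge a b ∧ D.IsOutwardNormal a b ν ∧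
    ∃ x ∈ segment ℝ a b, ∃ r : ℝ, 0 ≤ r ∧ r ≤ α ∧ y = x + r • ν}

/-- The cone of outward normal directions of the region at `u`. At a convex vertex it is the cone
spanned by the outward normals of the two edges that meet there; at a reflex vertex it is `{0}`. -/
def normalCone (u : Plane) : Set Plane :=
  {d | ∀ᶠ p in 𝓝[D.region] u, inner ℝ d (p - u) ≤ 0}

/-- The corner pieces of the inflation. At a convex vertex `u` the two shifted edges are extended
until they meet, and the piece is the kite bounded by the extended shifted edges and by the two
outward normals at `u`; at a reflex vertex nothing is added. -/
def corners (α : ℝ) : Set Plane :=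
  {x | ∃ u : Plane, (∃ b, D.IsEdge u b) ∧ x - u ∈ D.normalCone u ∧
    ∀ a b ν : Plane, D.IsEdge a b → (a = u ∨ b = u) → D.IsOutwardNormal a b ν →
      inner ℝ (x - u) ν ≤ α}

/-- The edge-inflation of the domain by `α`: every edge is shifted outwards by `α`, orthogonally to
itself, and consecutive shifted edges are extended (at convex vertices) or cut off (at reflex
vertices) where they meet. As a region, this is the domain with what its edges sweep and with the
corner pieces; parts of the inflated domain that grow into each other are merged. -/
def inflate (α : ℝ) : Set Plane := D.region ∪ D.sweep α ∪ D.corners α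

/-! ### Minimum-link paths -/

/-- The solution space `χ[α]`: the sequences of bends `v₁, …, vₖ₋₁` such that the polygonal path
`s, v₁, …, vₖ₋₁, t` runs inside the inflated domain, that is, consecutive points see each other. -/
def solutions (s t : Plane) (α : ℝ) : Set (List Plane) :=
  {v | List.IsChain (fun p q => segment ℝ p q ⊆ D.inflate α) (s :: (v ++ [t]))}

/-- The number of links (edges) of the path with bends `v`. -/
def links (v : List Plane) : ℕ := v.length + 1

/-- The minimum-link paths from `s` to `t` in the inflated domain. -/
def optimalSolutions (s t : Plane) (α : ℝ) : Set (List Plane) :=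
  {v ∈ D.solutions s t α | ∀ v' ∈ D.solutions s t α, links v ≤ links v'}

end PolygonalDomain

/-! ### Bit lengths -/

/-- Length of the binary representation of (the absolute value of) an integer. -/
def bitInt (z : ℤ) : ℕ := max 1 z.natAbs.size

/-- `BIT(p/q) = BIT(p) + BIT(q)` for a reduced fraction. -/
def bitRat (q : ℚ) : ℕ := bitInt q.num + bitInt q.den

/-- The input bit length of a list of rational points: the largest bit length of a coordinate. -/
def inputBits (v : List (ℚ × ℚ)) : ℕ :=
  (v.map fun p => max (bitRat p.1) (bitRat p.2)).foldr max 0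

/-- A list of rational points as a list of points of the plane. -/
def toPlane (v : List (ℚ × ℚ)) : List Plane :=
  v.map fun p => !₂[(p.1 : ℝ), (p.2 : ℝ)]

/-! ### The real RAM -/

/-- Arithmetic and boolean operations on words. -/
inductive WordOp
  | add | sub | mulLow | mulHigh | div | mod | nand

/-- Exact real operations. -/
inductive RealOp
  | add | sub | mul | div

/-- Instructions of the real RAM; `i j k` are constant words, `l` is a line of the program. -/
inductive Instr
  | wConst (i j : ℕ)                  -- W[i] ← j
  | rZero (i : ℕ)                     -- R[i] ← 0
  | rOne (i : ℕ)                      -- R[i] ← 1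
  | wCopy (i j : ℕ)                   -- W[i] ← W[j]
  | wStore (i j : ℕ)                  -- W[W[i]] ← W[j]
  | wLoad (i j : ℕ)                   -- W[i] ← W[W[j]]
  | rCopy (i j : ℕ)                   -- R[i] ← R[j]
  | rStore (i j : ℕ)                  -- R[W[i]] ← R[j]
  | rLoad (i j : ℕ)                   -- R[i] ← R[W[j]]
  | rCastConst (i j : ℕ)              -- R[i] ← j
  | rCast (i j : ℕ)                   -- R[i] ← W[j]
  | wOp (o : WordOp) (i j k : ℕ)      -- W[i] ← W[j] o W[k]
  | rOp (o : RealOp) (i j k : ℕ)      -- R[i] ← R[j] o R[k]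
  | ifWordEq (i j l : ℕ)              -- if W[i] = W[j] goto l
  | ifWordLt (i j l : ℕ)              -- if W[i] < W[j] goto l
  | ifRealZero (i l : ℕ)              -- if R[i] = 0 goto l
  | ifRealPos (i l : ℕ)               -- if R[i] > 0 goto l
  | goto (l : ℕ)
  | halt
  | accept
  | reject

/-- A program: its lines are numbered `1, 2, …`. -/
abbrev Program : Type := List Instr

/-- A configuration of the real RAM with word size `w`: the program counter, the word registers
and the real registers, both addressed by words. -/
structure Config (w : ℕ) where
  pc : ℕ
  word : BitVec w → BitVec w
  real : BitVec w → ℝ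

/-- The line of the program at the program counter. -/
def fetch (A : Program) (pc : ℕ) : Option Instr := if pc = 0 then none else A[pc - 1]?

/-- Word operations; division by zero is undefined. -/
def WordOp.eval {w : ℕ} (o : WordOp) (y z : BitVec w) : Option (BitVec w) :=
  match o with
  | .add => some (y + z)
  | .sub => some (y - z)
  | .mulLow => some (y * z)
  | .mulHigh => some (BitVec.ofNat w (y.toNat * z.toNat / 2 ^ w))
  | .div => if z = 0 then none else some (y / z)
  | .mod => if z = 0 then none else some (y % z)
  | .nand => some (~~~(y &&& z))

open Classical in
/-- Real operations; division by zero is undefined. -/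
def RealOp.eval (o : RealOp) (y z : ℝ) : Option ℝ :=
  match o with
  | .add => some (y + z)
  | .sub => some (y - z)
  | .mul => some (y * z)
  | .div => if z = 0 then none else some (y / z)

/-- The condition that an instruction tests, if it is a comparison. -/
def Instr.test {w : ℕ} (c : Config w) : Instr → Option Prop
  | .ifWordEq i j _ => some (c.word i = c.word j)
  | .ifWordLt i j _ => some (c.word i < c.word j)
  | .ifRealZero i _ => some (c.real i = 0)
  | .ifRealPos i _ => some (0 < c.real i)
  | _ => none

/-- Write a word register and go to the next line. -/
def Config.setWord {w : ℕ} (c : Config w) (i x : BitVec w) : Config w :=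
  ⟨c.pc + 1, Function.update c.word i x, c.real⟩

/-- Write a real register and go to the next line. -/
def Config.setReal {w : ℕ} (c : Config w) (i : BitVec w) (x : ℝ) : Config w :=
  ⟨c.pc + 1, c.word, Function.update c.real i x⟩

open Classical in
/-- Go to line `l` if `b` holds, to the next line otherwise. -/
def Config.branch {w : ℕ} (c : Config w) (b : Prop) (l : ℕ) : Config w :=
  if b then ⟨l, c.word, c.real⟩ else ⟨c.pc + 1, c.word, c.real⟩

/-- Execute one instruction; `none` if the machine stops. -/
def Instr.exec {w : ℕ} (c : Config w) : Instr → Option (Config w)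
  | .wConst i j => some (c.setWord i j)
  | .rZero i => some (c.setReal i 0)
  | .rOne i => some (c.setReal i 1)
  | .wCopy i j => some (c.setWord i (c.word j))
  | .wStore i j => some (c.setWord (c.word i) (c.word j))
  | .wLoad i j => some (c.setWord i (c.word (c.word j)))
  | .rCopy i j => some (c.setReal i (c.real j))
  | .rStore i j => some (c.setReal (c.word i) (c.real j))
  | .rLoad i j => some (c.setReal i (c.real (c.word j)))
  | .rCastConst i j => some (c.setReal i ((j : BitVec w).toNat : ℝ))
  | .rCast i j => some (c.setReal i ((c.word j).toNat : ℝ))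
  | .wOp o i j k => (o.eval (c.word j) (c.word k)).map (c.setWord i)
  | .rOp o i j k => (o.eval (c.real j) (c.real k)).map (c.setReal i)
  | .ifWordEq i j l => some (c.branch (c.word i = c.word j) l)
  | .ifWordLt i j l => some (c.branch (c.word i < c.word j) l)
  | .ifRealZero i l => some (c.branch (c.real i = 0) l)
  | .ifRealPos i l => some (c.branch (0 < c.real i) l)
  | .goto l => some ⟨l, c.word, c.real⟩
  | .halt => none
  | .accept => none
  | .reject => none

/-- The initial configuration on the input `(a, b)`: the real registers hold `a`, the word
registers hold the lengths of `a` and `b`, followed by `b`; all other registers are `0`. -/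
def initConfig (w : ℕ) (a : List ℝ) (b : List ℕ) : Config w where
  pc := 1
  word i := BitVec.ofNat w ((a.length :: b.length :: b).getD i.toNat 0)
  real i := a.getD i.toNat 0

/-- The configuration of program `A` after `k` steps; `none` once it has stopped. -/
def run {w : ℕ} (A : Program) (c : Config w) : ℕ → Option (Config w)
  | 0 => some c
  | k + 1 => (run A c k).bind fun c' => (fetch A c'.pc).bind (Instr.exec c')

/-- What is compared of two executions at a step: the program counter and, if the current
instruction is a comparison, its result. -/
def observe {w : ℕ} (A : Program) (c : Config w) : ℕ × Option Prop :=
  (c.pc, (fetch A c.pc).bind (Instr.test c))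

/-- `(a, b) ≅_A (a', b)`: the inputs have the same dimensions, and on both of them `A` is at the
same line at every step and every comparison gives the same result. -/
def Equivalent (A : Program) (w : ℕ) (a a' : List ℝ) (b : List ℕ) : Prop :=
  a.length = a'.length ∧
    ∀ k, (run A (initConfig w a b) k).map (observe A) =
      (run A (initConfig w a' b) k).map (observe A)

/-- The coordinates of a list of points. -/
def coords (v : List Plane) : List ℝ := v.flatMap fun p => [p 0, p 1]

namespace PolygonalDomain

variable (D : PolygonalDomain)

/-- The real input of a verification algorithm: `α`, the points `s` and `t`, the vertices of the
domain, and the bends of the path to be verified. -/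
def realInput (s t : Plane) (α : ℝ) (v : List Plane) : List ℝ :=
  α :: coords ([s, t] ++ (List.finRange D.numCycles).flatMap
    (fun j => List.ofFn (D.cycle j).vertices) ++ v)

/-- The integer input: the number of boundary polygons, their sizes, and the number of bends. -/
def intInput (v : List Plane) : List ℕ :=
  D.numCycles :: (List.ofFn D.size ++ [v.length])

/-- The input bit complexity `BIT_IN(v, A)` of a solution `v` with respect to the algorithm `A`
(on words of size `w`): the least input bit length of a rational `v'` such that `A` on `v'` makes
the same decisions as on `v`; it is `∞` if there is none. -/
def bitIn (A : Program) (w : ℕ) (s t : Plane) (α : ℝ) (v : List Plane) : ℕ∞ :=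
  ⨅ (v' : List (ℚ × ℚ)) (_ : v'.length = v.length)
    (_ : Equivalent A w (D.realInput s t α v) (D.realInput s t α (toPlane v')) (D.intInput v)),
    (inputBits v' : ℕ∞)

/-- `BIT(χ[α])`, the least input bit complexity with respect to `A` of a minimum-link path from `s`
to `t` in the domain inflated by `α`. -/
def bitOptWith (A : Program) (w : ℕ) (s t : Plane) (α : ℝ) : ℕ∞ :=
  ⨅ v ∈ D.optimalSolutions s t α, D.bitIn A w s t α v

/-- The least input bit length of a minimum-link path with rational bends from `s` to `t` in the
domain inflated by `α`; it is `∞` if all minimum-link paths have an irrational bend. This is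
`BIT(χ[α])` for every correct verification algorithm, one that accepts exactly the paths that run
inside the inflated domain: inputs on which it makes the same decisions are then both solutions or
both not. For an arbitrary algorithm it is an upper bound of `bitOptWith`. -/
def bitOpt (s t : Plane) (α : ℝ) : ℕ∞ :=
  ⨅ (v : List (ℚ × ℚ)) (_ : toPlane v ∈ D.optimalSolutions s t α), (inputBits v : ℕ∞)

end PolygonalDomain

/-- The expected cost when the augmentation `α` is uniformly distributed in `[0, δ]`. -/
def expectedCost (δ : ℝ) (cost : ℝ → ℕ∞) : ℝ≥0∞ :=
  ∫⁻ α, (cost α : ℝ≥0∞) ∂(ProbabilityTheory.cond MeasureTheory.volume (Set.Icc 0 δ))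

end MinLink

end

namespace MinLink

open Set Filter

/-! Let `k α` be the minimum number of links in the inflation by `α`. It is antitone, since the
inflations grow with `α`. Suppose that `k` does not drop between `α - ε` and `α`, where `ε = 2⁻ᵐ`.
Then an optimal path for `α - ε`, with its bends rounded to the grid of mesh `2⁻⁽ᵐ⁺¹⁾`, is still
valid for `α` and still optimal, and its bends have about `2m + log L` bits (`bitOpt_add_le`).
Validity rests on the geometric fact that the `ε`-neighbourhood of the inflation by `β` lies in the
inflation by `β + ε` (`mem_inflate_add`).

Bad values of `α` are rare. An antitone `k` with natural values drops over distance `ε` only on a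
set of measure at most `ε` times its initial value (`volume_drop_le`), and a grid argument in the
connected region gives `k α = O((L/α)²)` (`exists_links_le`). Discarding `α ≤ δ 2⁻ⁱ` and taking `m =
b + 3i`, with `b` of order `log (L/δ)`, the bit length exceeds `3b + 4 + 6i` with probability
`O(2⁻ⁱ)`; summing these tails gives the expectation. The number of vertices enters only through `n ≥
3`, which lets `log n` absorb the additive constant. -/

/-- Otherwise the interior and the complement of `R` would separate `S`. -/
theorem exists_mem_frontier_of_isPreconnected {X : Type*} [TopologicalSpace X] {S R : Set X}
    (hS : IsPreconnected S) (hR : IsClosed R) (h1 : (S ∩ R).Nonempty) (h2 : (S ∩ Rᶜ).Nonempty) :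
    (S ∩ frontier R).Nonempty := by
  by_contra hne
  rw [not_nonempty_iff_eq_empty] at hne
  have key : ∀ x ∈ S, x ∈ R → x ∈ interior R := by
    intro x hx hxR
    by_contra hxi
    have : x ∈ S ∩ frontier R := ⟨hx, subset_closure hxR, hxi⟩
    rw [hne] at this
    exact this
  obtain ⟨x, hxS, hxR⟩ := h1
  obtain ⟨y, -, hy1, hy2⟩ := hS (interior R) Rᶜ isOpen_interior hR.isOpen_compl
    (fun x hx => by
      by_cases h : x ∈ R
      · exact Or.inl (key x hx h)
      · exact Or.inr h) ⟨x, hxS, key x hxS hxR⟩ h2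
  exact hy2 (interior_subset hy1)

/-! ### Local structure at a vertex, and metric neighbourhoods of the region -/

namespace PolygonalDomain

variable {D : PolygonalDomain}

theorem isClosed_region : IsClosed D.region := D.isCompact.isClosed

theorem frontier_subset_region : frontier D.region ⊆ D.region := isClosed_region.frontier_subset

theorem mem_frontier_iff {f : Plane} :
    f ∈ frontier D.region ↔ ∃ a b, D.IsEdge a b ∧ f ∈ segment ℝ a b := by
  rw [D.frontier_eq]
  simp only [Polygon.boundary, Polygon.edgeSet, affineSegment_eq_segment, mem_iUnion]
  constructor
  · rintro ⟨j, i, h⟩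
    exact ⟨_, _, ⟨j, i, rfl, rfl⟩, h⟩
  · rintro ⟨a, b, ⟨j, i, rfl, rfl⟩, h⟩
    exact ⟨j, i, h⟩

theorem IsEdge.ne {a b : Plane} (h : D.IsEdge a b) : a ≠ b := by
  obtain ⟨j, i, rfl, rfl⟩ := h
  exact (D.simple j).2.1 i

theorem IsEdge.exists_next {a b : Plane} (h : D.IsEdge a b) : ∃ c, D.IsEdge b c := by
  obtain ⟨j, i, rfl, rfl⟩ := h
  exact ⟨_, j, _, rfl, rfl⟩

theorem IsEdge.eq_endpoint {u v a b : Plane} (hu : D.IsEdge u v) (h : D.IsEdge a b)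
    (hm : u ∈ segment ℝ a b) : u = a ∨ u = b := by
  obtain ⟨j, i, rfl, rfl⟩ := hu
  obtain ⟨j', i', rfl, rfl⟩ := h
  rw [← affineSegment_eq_segment] at hm
  have hl : D.cycle j i ∈ (D.cycle j).edgeSet ℝ i := left_mem_affineSegment ℝ _ _
  by_cases hj : j = j'
  · subst hj
    by_cases hi : i' = i
    · subst hi; exact Or.inl rfl
    · rcases (D.simple j).2.2 i' i hi _ ⟨hm, hl⟩ with ⟨h1, h2⟩ | ⟨h1, h2⟩
      · right; rw [h1]
      · left; exact h2
  · exact ((D.disjoint j j' hj).ne_of_mem (mem_iUnion.2 ⟨i, hl⟩) (mem_iUnion.2 ⟨i', hm⟩) rfl).elim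

/-- Near a vertex the boundary consists of the edges that end there. -/
theorem exists_radius {u v : Plane} (hu : D.IsEdge u v) :
    ∃ ρ > 0, ∀ f ∈ frontier D.region, dist f u < ρ →
      ∃ b, (D.IsEdge u b ∨ D.IsEdge b u) ∧ f ∈ segment ℝ u b ∧ ρ ≤ dist u b := by
  have hev : ∀ e : (Σ j, Fin (D.size j)), ∀ᶠ ρ in 𝓝[>] (0 : ℝ),
      ∀ f ∈ segment ℝ (D.cycle e.1 e.2) (D.cycle e.1 (finRotate _ e.2)), dist f u < ρ →
      ∃ b, (D.IsEdge u b ∨ D.IsEdge b u) ∧ f ∈ segment ℝ u b ∧ ρ ≤ dist u b := by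
    rintro ⟨j, i⟩
    set a := D.cycle j i with ha
    set b := D.cycle j (finRotate _ i) with hb
    have hab : D.IsEdge a b := ⟨j, i, rfl, rfl⟩
    by_cases hm : u ∈ segment ℝ a b
    · filter_upwards [nhdsWithin_le_nhds (Iic_mem_nhds (dist_pos.2 hab.ne))] with ρ hρ f hf _
      rcases hu.eq_endpoint hab hm with rfl | rfl
      · exact ⟨b, Or.inl hab, hf, hρ⟩
      · exact ⟨a, Or.inr hab, by rwa [segment_symm], by rwa [dist_comm]⟩
    · have hcl : IsClosed (segment ℝ a b) := by
        rw [segment_eq_image_lineMap]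
        exact (isCompact_Icc.image AffineMap.lineMap_continuous).isClosed
      have hpos : 0 < Metric.infDist u (segment ℝ a b) :=
        (hcl.notMem_iff_infDist_pos ⟨a, left_mem_segment ℝ a b⟩).1 hm
      filter_upwards [nhdsWithin_le_nhds (Iic_mem_nhds hpos)] with ρ hρ f hf hfu
      have := Metric.infDist_le_dist_of_mem (x := u) hf
      rw [dist_comm] at this
      have hρ' : ρ ≤ _ := hρ
      linarith
  obtain ⟨ρ, hρ, hρ0⟩ := ((eventually_all.2 hev).and self_mem_nhdsWithin).exists
  refine ⟨ρ, hρ0, fun f hf hfu => ?_⟩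
  obtain ⟨a, b, ⟨j, i, rfl, rfl⟩, hm⟩ := mem_frontier_iff.1 hf
  exact hρ ⟨j, i⟩ f hm hfu

/-- Near a vertex the region is a cone. -/
theorem smul_mem_region {u : Plane} {ρ : ℝ}
    (hρ : ∀ f ∈ frontier D.region, dist f u < ρ →
      ∃ b, (D.IsEdge u b ∨ D.IsEdge b u) ∧ f ∈ segment ℝ u b ∧ ρ ≤ dist u b)
    {w : Plane} {c : ℝ} (hw : u + w ∈ D.region) (hwρ : ‖w‖ < ρ) (hc : 0 < c) (hcρ : ‖c • w‖ < ρ) :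
    u + c • w ∈ D.region := by
  by_contra hn
  have hpre : IsPreconnected ((fun m : ℝ => u + m • w) '' uIcc 1 c) :=
    isPreconnected_uIcc.image _ (by fun_prop)
  -- If the ray leaves the region, it meets the frontier at some parameter `m`. That point lies on
  -- an edge through `u` of length at least `ρ`, so this edge contains the whole ray up to distance
  -- `ρ`, including the point assumed to be outside.
  obtain ⟨_, ⟨m, hm, rfl⟩, hf⟩ := exists_mem_frontier_of_isPreconnected hpre isClosed_region
    ⟨u + w, ⟨1, left_mem_uIcc, by simp⟩, hw⟩ ⟨u + c • w, ⟨c, right_mem_uIcc, rfl⟩, hn⟩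
  have hm0 : 0 < m := by
    rcases mem_uIcc.1 hm with h | h <;> linarith [h.1]
  have hmρ : ‖m • w‖ < ρ := by
    rw [norm_smul, Real.norm_of_nonneg hm0.le]
    rw [norm_smul, Real.norm_of_nonneg hc.le] at hcρ
    rcases mem_uIcc.1 hm with h | h <;> nlinarith [norm_nonneg w]
  obtain ⟨b, hb, hfb, hρb⟩ := hρ _ hf (by simpa [dist_eq_norm] using hmρ)
  apply hn
  apply frontier_subset_region
  have hseg : u + c • w ∈ segment ℝ u b := by
    rw [segment_eq_image'] at hfb ⊢
    obtain ⟨θ, ⟨hθ0, -⟩, hθ⟩ := hfb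
    have hθ' : θ • (b - u) = m • w := by simpa using hθ
    have hcw : c • w = (c / m * θ) • (b - u) := by
      rw [mul_smul, hθ', smul_smul, div_mul_cancel₀ _ hm0.ne']
    have hnn : 0 ≤ c / m * θ := by positivity
    refine ⟨c / m * θ, ⟨hnn, ?_⟩, by simp [hcw]⟩
    rw [hcw, norm_smul, Real.norm_of_nonneg hnn, ← dist_eq_norm, dist_comm b] at hcρ
    by_contra h1
    nlinarith [dist_nonneg (x := u) (y := b)]
  rcases hb with h | h
  · exact mem_frontier_iff.2 ⟨_, _, h, hseg⟩
  · exact mem_frontier_iff.2 ⟨_, _, h, by rwa [segment_symm]⟩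

/-- Shrinking `w` towards `0` keeps `u + w` in the region and does not change the sign of the inner
product, so the germ condition can be tested on a fixed ball. -/
theorem mem_normalCone_iff {u d : Plane} {ρ : ℝ} (hρ0 : 0 < ρ)
    (hρ : ∀ f ∈ frontier D.region, dist f u < ρ →
      ∃ b, (D.IsEdge u b ∨ D.IsEdge b u) ∧ f ∈ segment ℝ u b ∧ ρ ≤ dist u b) :
    d ∈ D.normalCone u ↔ ∀ w, u + w ∈ D.region → ‖w‖ < ρ → inner ℝ d w ≤ 0 := by
  constructor
  · intro hd w hw hwρ
    have hd' : ∀ᶠ p in 𝓝[D.region] u, inner ℝ d (p - u) ≤ 0 := hd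
    have ht : Tendsto (fun c : ℝ => u + c • w) (𝓝[>] 0) (𝓝[D.region] u) := by
      apply tendsto_nhdsWithin_iff.2 ⟨?_, ?_⟩
      · have : Tendsto (fun c : ℝ => u + c • w) (𝓝 0) (𝓝 (u + (0 : ℝ) • w)) :=
          (by fun_prop : Continuous fun c : ℝ => u + c • w).tendsto 0
        simpa using this.mono_left nhdsWithin_le_nhds
      · filter_upwards [self_mem_nhdsWithin,
          nhdsWithin_le_nhds (Iic_mem_nhds (zero_lt_one (α := ℝ)))] with c hc hc1
        have hc0 : 0 < c := hc
        have hc1' : c ≤ 1 := hc1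
        refine smul_mem_region hρ hw hwρ hc0 ?_
        rw [norm_smul, Real.norm_of_nonneg hc0.le]
        nlinarith [norm_nonneg w]
    obtain ⟨c, hc, hc0⟩ := ((ht.eventually hd').and self_mem_nhdsWithin).exists
    have hc0' : 0 < c := hc0
    rw [add_sub_cancel_left, inner_smul_right] at hc
    by_contra h
    push Not at h
    nlinarith [mul_pos hc0' h]
  · intro h
    have : ∀ᶠ p in 𝓝[D.region] u, p ∈ D.region ∧ p ∈ Metric.ball u ρ :=
      eventually_mem_nhdsWithin.and (nhdsWithin_le_nhds (Metric.ball_mem_nhds u hρ0))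
    filter_upwards [this] with p hp
    exact h _ (by simpa using hp.1) (by simpa [dist_eq_norm] using hp.2)

/-- The inflation contains the closed neighbourhood of the region. -/
theorem mem_inflate_of_dist_le {x p : Plane} {α : ℝ} (hp : p ∈ D.region) (h : dist x p ≤ α) :
    x ∈ D.inflate α := by
  by_cases hx : x ∈ D.region
  · exact Or.inl (Or.inl hx)
  obtain ⟨q, hq, hqd⟩ := D.isCompact.exists_infDist_eq_dist ⟨p, hp⟩ x
  -- A frontier point on the segment from a nearest point `q` to `x` is itself a nearest point. If
  -- it is a vertex, `x` lies in a corner piece; otherwise `x` lies in the rectangle swept by an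
  -- edge.
  obtain ⟨f, hfs, hff⟩ := exists_mem_frontier_of_isPreconnected
    (convex_segment q x).isPreconnected isClosed_region
    ⟨q, left_mem_segment ℝ q x, hq⟩ ⟨x, right_mem_segment ℝ q x, hx⟩
  have hmin : ∀ y ∈ D.region, ‖x - f‖ ≤ ‖x - y‖ := by
    intro y hy
    have h1 := Metric.infDist_le_dist_of_mem (x := x) hy
    rw [segment_eq_image'] at hfs
    obtain ⟨θ, hθ, rfl⟩ := hfs
    have : x - (q + θ • (x - q)) = (1 - θ) • (x - q) := by module
    rw [← dist_eq_norm x y, this, norm_smul, Real.norm_of_nonneg (by linarith [hθ.2]),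
      ← dist_eq_norm]
    nlinarith [hθ.1, dist_nonneg (x := x) (y := q)]
  have hfR := frontier_subset_region hff
  have hxf : x - f ≠ 0 := fun h0 => hx (by rwa [sub_eq_zero.1 h0])
  have hpos : 0 < ‖x - f‖ := norm_pos_iff.2 hxf
  have hle : ‖x - f‖ ≤ α := (hmin p hp).trans (by rwa [← dist_eq_norm])
  have hinner : ∀ y ∈ D.region, 2 * inner ℝ (x - f) (y - f) ≤ ‖y - f‖ ^ 2 := by
    intro y hy
    have h1 : ‖x - y‖ ^ 2 = ‖x - f‖ ^ 2 - 2 * inner ℝ (x - f) (y - f) + ‖y - f‖ ^ 2 := by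
      rw [← norm_sub_sq_real]; congr 2; abel
    have h2 := pow_le_pow_left₀ hpos.le (hmin y hy) 2
    linarith
  have hvertex : ∀ v, D.IsEdge f v → x ∈ D.inflate α := by
    intro v hv
    obtain ⟨ρ, hρ0, hρ⟩ := exists_radius hv
    refine Or.inr ⟨f, ⟨v, hv⟩, ?_, ?_⟩
    · rw [mem_normalCone_iff hρ0 hρ]
      intro w hw hwρ
      by_contra! hcon
      have hw0 : 0 < ‖w‖ ^ 2 := by
        have : w ≠ 0 := by rintro rfl; simp at hcon
        positivity
      -- So small that the quadratic term of `hinner` along `c • w` is at most half the linear one.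
      set c := min 1 (inner ℝ (x - f) w / ‖w‖ ^ 2) with hc
      have hc0 : 0 < c := lt_min one_pos (by positivity)
      have hc1 : c ≤ 1 := min_le_left _ _
      have hc2 : c * ‖w‖ ^ 2 ≤ inner ℝ (x - f) w := by
        rw [← le_div_iff₀ hw0]; exact min_le_right _ _
      have hcw : ‖c • w‖ < ρ := by
        rw [norm_smul, Real.norm_of_nonneg hc0.le]
        nlinarith [norm_nonneg w]
      have := hinner _ (smul_mem_region hρ hw hwρ hc0 hcw)
      rw [add_sub_cancel_left, inner_smul_right, norm_smul, mul_pow, Real.norm_of_nonneg hc0.le]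
        at this
      nlinarith [mul_pos hc0 hcon]
    · intro a b ν _ _ hν
      calc inner ℝ (x - f) ν ≤ ‖x - f‖ * ‖ν‖ := real_inner_le_norm _ _
        _ ≤ α := by rw [hν.1, mul_one]; exact hle
  obtain ⟨a, b, hab, hm⟩ := mem_frontier_iff.1 hff
  by_cases hfa : a = f
  · exact hvertex b (hfa ▸ hab)
  by_cases hfb : b = f
  · obtain ⟨c, hc⟩ := hab.exists_next
    exact hvertex c (hfb ▸ hc)
  have hop := mem_openSegment_of_ne_left_right hfa hfb hm
  refine Or.inl (Or.inr ⟨a, b, ‖x - f‖⁻¹ • (x - f), hab, ⟨?_, ?_, f, hop, ?_⟩, f, hm, ‖x - f‖,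
    hpos.le, hle, ?_⟩)
  · rw [norm_smul, norm_inv, norm_norm, inv_mul_cancel₀ hpos.ne']
  · have hsub : segment ℝ a b ⊆ D.region := fun y hy =>
      frontier_subset_region (mem_frontier_iff.2 ⟨a, b, hab, hy⟩)
    rw [openSegment_eq_image'] at hop
    obtain ⟨θ, ⟨h0, h1⟩, rfl⟩ := hop
    dsimp only at *
    set d := x - (a + θ • (b - a)) with hd
    set J := inner ℝ d (b - a) with hJ
    -- First-order condition along the edge: `c` may have either sign because `f` is a relative
    -- interior point, which forces `J = 0`.
    have hkey : ∀ c, 0 ≤ θ + c → θ + c ≤ 1 → 2 * (c * J) ≤ c ^ 2 * ‖b - a‖ ^ 2 := by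
      intro c hc0 hc1
      have := hinner (a + (θ + c) • (b - a)) (hsub (by
        rw [segment_eq_image']; exact ⟨θ + c, ⟨hc0, hc1⟩, rfl⟩))
      have he : a + (θ + c) • (b - a) - (a + θ • (b - a)) = c • (b - a) := by module
      rw [he, inner_smul_right, norm_smul, mul_pow, Real.norm_eq_abs, sq_abs] at this
      exact this
    rw [real_inner_smul_left]
    suffices J = 0 by rw [← hJ, this, mul_zero]
    have hn : 0 < ‖b - a‖ ^ 2 := by
      have : b - a ≠ 0 := sub_ne_zero.2 hab.ne.symm
      positivity
    by_contra hJ0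
    set N := ‖b - a‖ ^ 2
    have hm1 : 0 < min θ (1 - θ) := lt_min h0 (by linarith)
    have hJp : 0 < |J| := abs_pos.2 hJ0
    set e := min (min θ (1 - θ)) (|J| / N) with he
    have he0 : 0 < e := lt_min hm1 (by positivity)
    have he1 : e ≤ θ := (min_le_left _ _).trans (min_le_left _ _)
    have he2 : e ≤ 1 - θ := (min_le_left _ _).trans (min_le_right _ _)
    have he3 : e * N ≤ |J| := by rw [← le_div_iff₀ hn]; exact min_le_right _ _
    rcases abs_cases J with ⟨hj, hj'⟩ | ⟨hj, hj'⟩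
    · have := hkey e (by linarith) (by linarith)
      rw [hj] at he3 hJp
      nlinarith [mul_pos he0 hJp]
    · have := hkey (-e) (by linarith) (by linarith)
      rw [hj] at he3 hJp
      nlinarith [mul_pos he0 hJp]
  · filter_upwards [self_mem_nhdsWithin, nhdsWithin_le_nhds (Iio_mem_nhds hpos)] with r hr hr1 hcon
    have hr0 : 0 < r := hr
    have hr1' : r < ‖x - f‖ := hr1
    have h1 := hinner _ hcon
    rw [add_sub_cancel_left, inner_smul_right, inner_smul_right, real_inner_self_eq_norm_sq,
      norm_smul, norm_smul, norm_inv, norm_norm, inv_mul_cancel₀ hpos.ne',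
      Real.norm_of_nonneg hr0.le] at h1
    have h2 : ‖x - f‖⁻¹ * ‖x - f‖ ^ 2 = ‖x - f‖ := by field_simp
    rw [h2] at h1
    nlinarith
  · rw [smul_smul, mul_inv_cancel₀ hpos.ne', one_smul]; abel

end PolygonalDomain
end MinLink

/-! ### Neighbourhoods of an inflation -/

namespace MinLink

open Set Filter

namespace PolygonalDomain

variable {D : PolygonalDomain}

theorem inflate_mono : Monotone D.inflate := by
  rintro α β h x ((hx | hx) | hx)
  · exact Or.inl (Or.inl hx)
  · obtain ⟨a, b, ν, h1, h2, y, hy, r, hr, hr', rfl⟩ := hx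
    exact Or.inl (Or.inr ⟨a, b, ν, h1, h2, y, hy, r, hr, hr'.trans h, rfl⟩)
  · obtain ⟨u, hu, hN, hx⟩ := hx
    exact Or.inr ⟨u, hu, hN, fun a b ν h1 h2 h3 => (hx a b ν h1 h2 h3).trans h⟩

/-- A nonzero vector of the normal cone at a vertex that is orthogonal to the direction of a point
of the region nearby is a multiple of the outward normal of an edge that ends at the vertex. -/
theorem exists_edge_of_inner_eq_zero {u d w : Plane} {ρ : ℝ}
    (hρ : ∀ f ∈ frontier D.region, dist f u < ρ →
      ∃ b, (D.IsEdge u b ∨ D.IsEdge b u) ∧ f ∈ segment ℝ u b ∧ ρ ≤ dist u b)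
    (hd : ∀ w, u + w ∈ D.region → ‖w‖ < ρ → inner ℝ d w ≤ 0) (hd0 : d ≠ 0)
    (hw : u + w ∈ D.region) (hw0 : w ≠ 0) (hwρ : ‖w‖ < ρ) (hdw : inner ℝ d w = 0) :
    ∃ a b, D.IsEdge a b ∧ (a = u ∨ b = u) ∧ D.IsOutwardNormal a b (‖d‖⁻¹ • d) := by
  have hdpos : 0 < ‖d‖ := norm_pos_iff.2 hd0
  have hdd : inner ℝ d d = ‖d‖ ^ 2 := real_inner_self_eq_norm_sq d
  -- Pushing a vector orthogonal to `d` in the direction `d` makes its inner product with `d`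
  -- positive, which `hd` forbids inside the region.
  have hout : ∀ v, ‖v‖ < ρ → inner ℝ d v = 0 → ∀ k : ℝ, 0 < k → ∀ᶠ r in 𝓝[>] (0 : ℝ),
      u + v + r • k • d ∉ D.region := by
    intro v hv hdv k hk
    have hc : Tendsto (fun r : ℝ => ‖v + r • k • d‖) (𝓝 0) (𝓝 ‖v + (0 : ℝ) • k • d‖) :=
      (by fun_prop : Continuous fun r : ℝ => ‖v + r • k • d‖).tendsto 0
    rw [zero_smul, add_zero] at hc
    filter_upwards [self_mem_nhdsWithin, nhdsWithin_le_nhds (hc (Iio_mem_nhds hv))]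
      with r hr hr1 hcon
    have hr0 : 0 < r := hr
    rw [add_assoc] at hcon
    have := hd _ hcon hr1
    rw [inner_add_right, hdv, inner_smul_right, inner_smul_right, hdd] at this
    have : 0 < r * (k * ‖d‖ ^ 2) := by positivity
    linarith
  have hfr : u + w ∈ frontier D.region := by
    refine ⟨subset_closure hw, fun hint => ?_⟩
    have hc : Tendsto (fun r : ℝ => u + w + r • (1 : ℝ) • d) (𝓝 0)
        (𝓝 (u + w + (0 : ℝ) • (1 : ℝ) • d)) :=
      (by fun_prop : Continuous fun r : ℝ => u + w + r • (1 : ℝ) • d).tendsto 0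
    rw [zero_smul, add_zero] at hc
    obtain ⟨r, hr1, hr2⟩ := ((hout w hwρ hdw 1 one_pos).and
      (nhdsWithin_le_nhds (hc (isOpen_interior.mem_nhds hint)))).exists
    exact hr1 (interior_subset (s := D.region) hr2)
  obtain ⟨b, hb, hseg, hρb⟩ := hρ _ hfr (by simpa [dist_eq_norm] using hwρ)
  rw [segment_eq_image'] at hseg
  obtain ⟨θ, ⟨hθ0, hθ1⟩, hθ⟩ := hseg
  have hθw : θ • (b - u) = w := by simpa using hθ
  have hθpos : 0 < θ := lt_of_le_of_ne hθ0 (by rintro rfl; simp at hθw; exact hw0 hθw.symm)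
  have horth : inner ℝ d (b - u) = 0 := by
    rw [← hθw, inner_smul_right] at hdw
    exact (mul_eq_zero.1 hdw).resolve_left hθpos.ne'
  have hnorm : ‖‖d‖⁻¹ • d‖ = 1 := by
    rw [norm_smul, norm_inv, norm_norm, inv_mul_cancel₀ hdpos.ne']
  -- Halving `θ` avoids the end point `b`, since `θ = 1` is possible.
  have hx : u + (2⁻¹ * θ) • (b - u) ∈ openSegment ℝ u b := by
    rw [openSegment_eq_image']
    exact ⟨2⁻¹ * θ, ⟨by positivity, by linarith⟩, rfl⟩
  have hxo : ∀ᶠ r in 𝓝[>] (0 : ℝ), u + (2⁻¹ * θ) • (b - u) + r • ‖d‖⁻¹ • d ∉ D.region := by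
    refine hout ((2⁻¹ * θ) • (b - u)) ?_ ?_ ‖d‖⁻¹ (inv_pos.2 hdpos)
    · rw [mul_smul, hθw, norm_smul, Real.norm_of_nonneg (by norm_num)]
      linarith [norm_nonneg w]
    · rw [inner_smul_right, horth, mul_zero]
  rcases hb with hb | hb
  · exact ⟨u, b, hb, Or.inl rfl, hnorm, by rw [real_inner_smul_left, horth, mul_zero], _, hx, hxo⟩
  · refine ⟨b, u, hb, Or.inr rfl, hnorm, ?_, _, by rwa [openSegment_symm], hxo⟩
    rw [← neg_sub, inner_neg_right, real_inner_smul_left, horth, mul_zero, neg_zero]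

/-- On a segment that leaves the normal cone of a vertex there is a point where it leaves. -/
theorem exists_exit {u d d' : Plane} {ρ : ℝ} (hρ0 : 0 < ρ)
    (hρ : ∀ f ∈ frontier D.region, dist f u < ρ →
      ∃ b, (D.IsEdge u b ∨ D.IsEdge b u) ∧ f ∈ segment ℝ u b ∧ ρ ≤ dist u b)
    (hd : ∀ w, u + w ∈ D.region → ‖w‖ < ρ → inner ℝ d w ≤ 0)
    (hd' : ¬ ∀ w, u + w ∈ D.region → ‖w‖ < ρ → inner ℝ d' w ≤ 0) :
    ∃ l ∈ Icc (0 : ℝ) 1, (∀ w, u + w ∈ D.region → ‖w‖ < ρ → inner ℝ (d + l • (d' - d)) w ≤ 0) ∧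
      ∃ w, w ≠ 0 ∧ u + w ∈ D.region ∧ ‖w‖ < ρ ∧ inner ℝ (d + l • (d' - d)) w = 0 := by
  have hscale : ∀ w, u + w ∈ D.region → ‖w‖ < ρ → w ≠ 0 →
      ∃ c : ℝ, 0 < c ∧ ‖c • w‖ = ρ / 2 ∧ u + c • w ∈ D.region := by
    intro w hw hwρ hw0
    have hn : 0 < ‖w‖ := norm_pos_iff.2 hw0
    have hc : 0 < ρ / 2 * ‖w‖⁻¹ := by positivity
    have he : ‖(ρ / 2 * ‖w‖⁻¹) • w‖ = ρ / 2 := by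
      rw [norm_smul, Real.norm_of_nonneg hc.le, mul_assoc, inv_mul_cancel₀ hn.ne', mul_one]
    have hlt : ‖(ρ / 2 * ‖w‖⁻¹) • w‖ < ρ := by rw [he]; exact half_lt_self hρ0
    exact ⟨ρ / 2 * ‖w‖⁻¹, hc, he, smul_mem_region hρ hw hwρ hc hlt⟩
  set K : Set Plane := Metric.sphere 0 (ρ / 2) ∩ {w | u + w ∈ D.region} with hK
  have hcl : IsClosed {w : Plane | u + w ∈ D.region} := by
    have hc : Continuous fun w : Plane => u + w := by fun_prop
    exact isClosed_region.preimage hc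
  have hKc : IsCompact K := (isCompact_sphere (0 : Plane) (ρ / 2)).inter_right hcl
  -- By the cone property, directions can be tested on the compact set `K`. The exit parameter is
  -- the least `l` for which some direction in `K` has nonnegative inner product.
  set S : Set (ℝ × Plane) := (Icc (0 : ℝ) 1 ×ˢ K) ∩ {p | 0 ≤ inner ℝ (d + p.1 • (d' - d)) p.2}
    with hS
  have hSc : IsCompact S := (isCompact_Icc.prod hKc).inter_right
    (isClosed_le continuous_const
    ((continuous_const.add (continuous_fst.smul continuous_const)).inner continuous_snd))
  have hSne : S.Nonempty := by
    push Not at hd'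
    obtain ⟨w, hw, hwρ, hpos⟩ := hd'
    obtain ⟨c, hc, h1, h2⟩ := hscale w hw hwρ (by rintro rfl; simp at hpos)
    refine ⟨(1, c • w), ⟨⟨by simp, ⟨by simpa using h1, h2⟩⟩, ?_⟩⟩
    simp only [mem_ofPred_eq, one_smul, add_sub_cancel, inner_smul_right]
    positivity
  obtain ⟨⟨l, w⟩, ⟨⟨hl, hwK, hw⟩, hlw⟩, hmin⟩ := hSc.exists_isMinOn hSne continuous_fst.continuousOn
  have hwn : ‖w‖ = ρ / 2 := by simpa using hwK
  have hwρ : ‖w‖ < ρ := by rw [hwn]; linarith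
  have hin : ∀ v (m : ℝ), inner ℝ (d + m • (d' - d)) v = inner ℝ d v + m * inner ℝ (d' - d) v := by
    intro v m
    rw [inner_add_left, real_inner_smul_left]
  have hle : ∀ v, u + v ∈ D.region → ‖v‖ < ρ → inner ℝ (d + l • (d' - d)) v ≤ 0 := by
    intro v hv hvρ
    by_cases hv0 : v = 0
    · simp [hv0]
    obtain ⟨c, hc, h1, h2⟩ := hscale v hv hvρ hv0
    by_contra! hpos
    have hdv := hd v hv hvρ
    rw [hin] at hpos
    set A := inner ℝ d v
    set B := inner ℝ (d' - d) v with hB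
    have hBpos : 0 < B := by
      by_contra! h
      nlinarith [hl.1]
    -- The affine function `A + m * B` vanishes at `-A / B`; a positive value at `l` would put this
    -- zero before `l`, against minimality.
    have hm : ((-A / B, c • v) : ℝ × Plane) ∈ S := by
      have hlt : -A / B < l := by rw [div_lt_iff₀ hBpos]; linarith
      refine ⟨⟨⟨div_nonneg (by linarith) hBpos.le, hlt.le.trans hl.2⟩, by simpa using h1, h2⟩, ?_⟩
      rw [mem_ofPred_eq, hin, inner_smul_right, inner_smul_right, ← mul_left_comm, ← mul_add, ← hB, div_mul_cancel₀ _ hBpos.ne']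
      simp [A]
    have : l ≤ -A / B := hmin hm
    rw [le_div_iff₀ hBpos] at this
    linarith
  refine ⟨l, hl, hle, w, ?_, hw, hwρ, le_antisymm (hle w hw hwρ) hlw⟩
  rw [← norm_pos_iff, hwn]; positivity

/-- Points at distance `ε` of the inflation by `β` lie in the inflation by `β + ε`. -/
theorem mem_inflate_add {x y : Plane} {β ε : ℝ} (hβ : 0 ≤ β) (hx : x ∈ D.inflate β)
    (hxy : dist y x ≤ ε) : y ∈ D.inflate (β + ε) := by
  have hε : 0 ≤ ε := dist_nonneg.trans hxy
  rcases hx with (hx | ⟨a, b, ν, hab, hν, p, hp, r, hr0, hr, rfl⟩) | ⟨u, ⟨v, hv⟩, hN, hx⟩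
  · exact mem_inflate_of_dist_le hx (by linarith)
  · refine mem_inflate_of_dist_le (p := p)
      (frontier_subset_region (mem_frontier_iff.2 ⟨a, b, hab, hp⟩)) ?_
    have h1 : dist (p + r • ν) p = r := by
      rw [dist_eq_norm, add_sub_cancel_left, norm_smul, hν.1, mul_one, Real.norm_of_nonneg hr0]
    linarith [dist_triangle y (p + r • ν) p]
  have huR : u ∈ D.region :=
    frontier_subset_region (mem_frontier_iff.2 ⟨u, v, hv, left_mem_segment ℝ u v⟩)
  obtain ⟨ρ, hρ0, hρ⟩ := exists_radius hv
  rw [mem_normalCone_iff hρ0 hρ] at hN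
  have hshift : ∀ ν z : Plane, ‖ν‖ = 1 → inner ℝ (z - u) ν ≤ inner ℝ (x - u) ν + ‖z - x‖ := by
    intro ν z hν
    have h1 : z - u = (x - u) + (z - x) := by abel
    have h2 := real_inner_le_norm (z - x) ν
    rw [hν, mul_one] at h2
    rw [h1, inner_add_left]
    linarith
  rw [dist_eq_norm] at hxy
  by_cases hN' : ∀ w, u + w ∈ D.region → ‖w‖ < ρ → inner ℝ (y - u) w ≤ 0
  · refine Or.inr ⟨u, ⟨v, hv⟩, (mem_normalCone_iff hρ0 hρ).2 hN', fun a b ν h1 h2 h3 => ?_⟩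
    linarith [hx a b ν h1 h2 h3, hshift ν y h3.1]
  obtain ⟨l, ⟨hl0, hl1⟩, hle, w, hw0, hw, hwρ, hdw⟩ := exists_exit hρ0 hρ hN hN'
  set d := x - u + l • (y - u - (x - u)) with hd
  have hdx : d = (x + l • (y - x)) - u := by rw [hd]; module
  -- At the exit point a nonzero `d` is a positive multiple of the outward normal of an edge at `u`,
  -- so the kite inequality for that edge bounds the whole norm of `d`. Then `y` is within `β + ε`
  -- of `u` itself.
  have hnd : ‖d‖ ≤ β + l * ‖y - x‖ := by
    by_cases hd0 : d = 0
    · rw [hd0, norm_zero]; positivity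
    obtain ⟨a, b, hab, hu, hν⟩ := exists_edge_of_inner_eq_zero hρ hle hd0 hw hw0 hwρ hdw
    have h1 := hshift _ (x + l • (y - x)) hν.1
    have h2 := hx a b _ hab hu hν
    have h3 : inner ℝ d (‖d‖⁻¹ • d) = ‖d‖ := by
      have : ‖d‖ ≠ 0 := norm_ne_zero_iff.2 hd0
      rw [inner_smul_right, real_inner_self_eq_norm_sq]; field_simp
    rw [← hdx, h3, add_sub_cancel_left, norm_smul, Real.norm_of_nonneg hl0] at h1
    linarith
  refine mem_inflate_of_dist_le huR ?_
  have he : y - u = d + (1 - l) • (y - x) := by rw [hd]; module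
  rw [dist_eq_norm, he]
  have h1 := norm_add_le d ((1 - l) • (y - x))
  rw [norm_smul, Real.norm_of_nonneg (by linarith : (0 : ℝ) ≤ 1 - l)] at h1
  nlinarith

end PolygonalDomain
end MinLink

namespace MinLink

open Set Filter

/-! ### Chains of points in a connected space -/

/-- Join two classes of `c` when their representatives are within `h + 2 * r`. The set of points
whose class is reachable from that of `s` is clopen, hence everything, and a path in this graph
visits each class at most once. -/
theorem exists_isChain_dist_le {X T : Type*} [PseudoMetricSpace X] [PreconnectedSpace X]
    [Fintype T] (c : X → T) {h r : ℝ} (hh : 0 < h) (hr : 0 ≤ r)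
    (hc : ∀ p q, c p = c q → dist p q ≤ r) (s t : X) :
    ∃ v : List X, v.length ≤ Fintype.card T ∧
      List.IsChain (fun p q => dist p q ≤ h + 2 * r) (s :: (v ++ [t])) := by
  classical
  have : Nonempty X := ⟨s⟩
  set rep : T → X := Function.invFun c with hrep
  have hdist : ∀ p, dist p (rep (c p)) ≤ r := fun p =>
    hc _ _ (Function.invFun_eq (f := c) ⟨p, rfl⟩).symm
  let G : SimpleGraph T :=
    { Adj := fun a b => a ≠ b ∧ dist (rep a) (rep b) ≤ h + 2 * r
      symm := ⟨fun a b hab => ⟨hab.1.symm, by rw [dist_comm]; exact hab.2⟩⟩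
      loopless := ⟨fun a ha => ha.1 rfl⟩ }
  have hnear : ∀ p q, dist p q ≤ h → G.Reachable (c p) (c q) := by
    intro p q hpq
    by_cases he : c p = c q
    · rw [he]
    · refine SimpleGraph.Adj.reachable ⟨he, ?_⟩
      have h1 := dist_triangle4 (rep (c p)) p q (rep (c q))
      rw [dist_comm (rep (c p)) p] at h1
      linarith [hdist p, hdist q]
  have hreach : G.Reachable (c s) (c t) := by
    have hlc : IsLocallyConstant fun p => G.Reachable (c s) (c p) := by
      rw [IsLocallyConstant.iff_eventually_eq]
      intro p
      filter_upwards [Metric.closedBall_mem_nhds p hh] with q hq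
      have hqp := hnear q p hq
      exact propext ⟨fun h => h.trans hqp, fun h => h.trans hqp.symm⟩
    have := hlc.apply_eq_of_preconnectedSpace s t
    exact this.mp (SimpleGraph.Reachable.refl _)
  obtain ⟨w, hw⟩ := hreach.exists_isPath
  refine ⟨w.support.map rep, ?_, ?_⟩
  · rw [List.length_map, SimpleGraph.Walk.length_support]
    exact hw.length_lt
  · have key : ∀ (a b : T) (w : G.Walk a b) (x : X), dist x (rep a) ≤ h + 2 * r →
        dist (rep b) t ≤ h + 2 * r →
        List.IsChain (fun p q => dist p q ≤ h + 2 * r) (x :: (w.support.map rep ++ [t])) := by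
      intro a b w
      induction w with
      | nil => intro x hx ht; simpa using ⟨hx, ht⟩
      | cons hab w ih =>
        intro x hx ht
        rw [SimpleGraph.Walk.support_cons, List.map_cons, List.cons_append,
          List.isChain_cons_cons]
        exact ⟨hx, ih _ hab.2 ht⟩
    refine key _ _ w s ?_ ?_
    · linarith [hdist s]
    · rw [dist_comm]; linarith [hdist t]

/-! ### The planar grid -/

/-- The index of the cell that contains `p` in the grid of mesh `h`. -/
noncomputable def cell (h : ℝ) (p : Plane) : ℤ × ℤ := (⌊p 0 / h⌋, ⌊p 1 / h⌋)

theorem dist_le_of_abs_le {p q : Plane} {e : ℝ} (h0 : |p 0 - q 0| ≤ e) (h1 : |p 1 - q 1| ≤ e) :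
    dist p q ≤ 3 / 2 * e := by
  have he : 0 ≤ e := (abs_nonneg _).trans h0
  rw [EuclideanSpace.dist_eq, Fin.sum_univ_two, Real.sqrt_le_left (by positivity), Real.dist_eq,
    Real.dist_eq]
  nlinarith [abs_nonneg (p 0 - q 0), abs_nonneg (p 1 - q 1)]

theorem dist_le_of_cell_eq {p q : Plane} {h : ℝ} (hh : 0 < h) (hpq : cell h p = cell h q) :
    dist p q ≤ 3 / 2 * h := by
  have key : ∀ x y : ℝ, ⌊x / h⌋ = ⌊y / h⌋ → |x - y| ≤ h := by
    intro x y hxy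
    have := Int.abs_sub_lt_one_of_floor_eq_floor hxy
    rw [← sub_div, abs_div, abs_of_pos hh, div_lt_one hh] at this
    exact this.le
  rw [cell, cell, Prod.mk.injEq] at hpq
  exact dist_le_of_abs_le (key _ _ hpq.1) (key _ _ hpq.2)

theorem floor_div_mem_Icc {x h L : ℝ} (hh : 0 < h) (hx : |x| ≤ L) :
    ⌊x / h⌋ ∈ Finset.Icc (-(⌈L / h⌉₊ : ℤ)) ⌈L / h⌉₊ := by
  have h1 : |x / h| ≤ ⌈L / h⌉₊ := by
    rw [abs_div, abs_of_pos hh]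
    exact (by gcongr : |x| / h ≤ L / h).trans (Nat.le_ceil _)
  rw [abs_le] at h1
  rw [Finset.mem_Icc, Int.le_floor]
  refine ⟨by push_cast; exact h1.1, ?_⟩
  have := (Int.floor_le (x / h)).trans h1.2
  exact_mod_cast this

/-! ### Bit lengths -/

/-- Reducing the fraction only shrinks both parts; the denominator `2 ^ m` has `m + 1` bits. -/
theorem bitRat_div_two_pow_le {z : ℤ} {m e : ℕ} (hz : |z| < 2 ^ e) (he : 1 ≤ e) :
    bitRat ((z : ℚ) / 2 ^ m) ≤ e + (m + 1) := by
  have hq : (z : ℚ) / 2 ^ m = Rat.divInt z (2 ^ m : ℤ) := by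
    rw [Rat.divInt_eq_div]; push_cast; rfl
  rw [hq]
  refine Nat.add_le_add (max_le he (Nat.size_le.2 ?_)) (max_le (by omega) (Nat.size_le.2 ?_))
  · by_cases hz0 : z = 0
    · subst hz0; simp
    · have h1 := Int.natAbs_dvd_natAbs.2 (Rat.num_dvd z (pow_ne_zero m (two_ne_zero (α := ℤ))))
      have h2 := Nat.le_of_dvd (Int.natAbs_pos.2 hz0) h1
      have h3 : z.natAbs < 2 ^ e := by
        zify; exact hz
      exact h2.trans_lt h3
  · have h1 := Int.natAbs_dvd_natAbs.2 (Rat.den_dvd z (2 ^ m : ℤ))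
    have h2 := Nat.le_of_dvd (by positivity) h1
    rw [Int.natAbs_pow] at h2
    calc _ ≤ 2 ^ m := by simpa using h2
      _ < 2 ^ (m + 1) := Nat.pow_lt_pow_right (by norm_num) (by omega)

theorem inputBits_le {v : List (ℚ × ℚ)} {B : ℕ}
    (h : ∀ p ∈ v, bitRat p.1 ≤ B ∧ bitRat p.2 ≤ B) : inputBits v ≤ B := by
  induction v with
  | nil => exact Nat.zero_le _
  | cons p v ih =>
    rw [List.forall_mem_cons] at h
    exact max_le (max_le h.1.1 h.1.2) (ih h.2)

/-- The lower left corner of the cell of `p` in the grid of mesh `2⁻ᵐ`. -/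
noncomputable def roundPoint (m : ℕ) (p : Plane) : ℚ × ℚ :=
  (⌊p 0 * 2 ^ m⌋ / 2 ^ m, ⌊p 1 * 2 ^ m⌋ / 2 ^ m)

theorem abs_floor_mul_div_sub_le (x : ℝ) (m : ℕ) :
    |((⌊x * 2 ^ m⌋ / 2 ^ m : ℚ) : ℝ) - x| ≤ (1 / 2) ^ m := by
  have hm : (0 : ℝ) < 2 ^ m := by positivity
  push_cast
  have h1 := Int.floor_le (x * 2 ^ m)
  have h2 := Int.lt_floor_add_one (x * 2 ^ m)
  have he : (⌊x * 2 ^ m⌋ : ℝ) / 2 ^ m - x = (⌊x * 2 ^ m⌋ - x * 2 ^ m) / 2 ^ m := by field_simp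
  rw [he, abs_div, abs_of_pos hm, div_le_iff₀ hm, ← mul_pow, abs_le]
  norm_num
  constructor <;> linarith

theorem abs_floor_mul_lt {x L : ℝ} {m e : ℕ} (hx : |x| ≤ L) (hL : L ≤ 2 ^ e) :
    |⌊x * 2 ^ m⌋| < 2 ^ (e + m + 1) := by
  have hm : (0 : ℝ) < 2 ^ m := by positivity
  have h1 : |x * 2 ^ m| ≤ 2 ^ (e + m) := by
    rw [abs_mul, abs_of_pos hm, pow_add]
    gcongr
    exact hx.trans hL
  rw [abs_le] at h1
  have h2 : -(2 ^ (e + m) : ℤ) ≤ ⌊x * 2 ^ m⌋ := by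
    rw [Int.le_floor]; push_cast; exact h1.1
  have h3 : ⌊x * 2 ^ m⌋ ≤ 2 ^ (e + m) := by
    have := (Int.floor_le (x * 2 ^ m)).trans h1.2
    exact_mod_cast this
  have h4 : (2 : ℤ) ^ (e + m + 1) = 2 * 2 ^ (e + m) := by ring
  have h5 : (0 : ℤ) < 2 ^ (e + m) := by positivity
  rw [abs_lt]
  constructor <;> linarith

theorem dist_roundPoint_le (m : ℕ) (p : Plane) :
    dist (!₂[((roundPoint m p).1 : ℝ), ((roundPoint m p).2 : ℝ)] : Plane) p ≤
      3 / 2 * (1 / 2) ^ m :=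
  dist_le_of_abs_le (abs_floor_mul_div_sub_le (p 0) m) (abs_floor_mul_div_sub_le (p 1) m)

/-! ### Rounding paths, and measurability of the bit length -/

namespace PolygonalDomain

variable {D : PolygonalDomain} {s t : Plane}

theorem solutions_mono : Monotone (D.solutions s t) := fun _ _ h _ hv =>
  List.IsChain.imp (fun _ _ hpq => hpq.trans (inflate_mono h)) hv

theorem mem_inflate_of_mem_solutions {α : ℝ} {v : List Plane} (hv : v ∈ D.solutions s t α)
    {p : Plane} (hp : p ∈ v) : p ∈ D.inflate α := by
  have hv' : List.IsChain (fun p q => segment ℝ p q ⊆ D.inflate α) (s :: (v ++ [t])) := hv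
  clear hv
  induction v generalizing s with
  | nil => simp at hp
  | cons a v ih =>
    rw [List.cons_append, List.isChain_cons_cons] at hv'
    rcases List.mem_cons.1 hp with rfl | hp
    · exact hv'.1 (right_mem_segment ℝ s p)
    · exact ih hp hv'.2

theorem segment_subset_inflate_add {a b a' b' : Plane} {β ε : ℝ} (hβ : 0 ≤ β)
    (h : segment ℝ a b ⊆ D.inflate β) (ha : dist a' a ≤ ε) (hb : dist b' b ≤ ε) :
    segment ℝ a' b' ⊆ D.inflate (β + ε) := by
  rintro _ ⟨x, y, hx, hy, hxy, rfl⟩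
  refine mem_inflate_add hβ (h ⟨x, y, hx, hy, hxy, rfl⟩) ?_
  rw [dist_eq_norm] at *
  have he : x • a' + y • b' - (x • a + y • b) = x • (a' - a) + y • (b' - b) := by module
  rw [he]
  calc _ ≤ ‖x • (a' - a)‖ + ‖y • (b' - b)‖ := norm_add_le _ _
    _ = x * ‖a' - a‖ + y * ‖b' - b‖ := by
      rw [norm_smul, norm_smul, Real.norm_of_nonneg hx, Real.norm_of_nonneg hy]
    _ ≤ x * ε + y * ε := by gcongr
    _ = ε := by rw [← add_mul, hxy, one_mul]

theorem map_mem_solutions {v : List Plane} {β ε : ℝ} (hβ : 0 ≤ β) (hε : 0 ≤ ε)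
    (hv : v ∈ D.solutions s t β) {f : Plane → Plane} (hf : ∀ p, dist (f p) p ≤ ε) :
    v.map f ∈ D.solutions s t (β + ε) := by
  -- The start is allowed to move as well, because after one link the induction starts from the
  -- moved bend.
  have key : ∀ (v : List Plane) (s s' : Plane), dist s' s ≤ ε →
      List.IsChain (fun p q => segment ℝ p q ⊆ D.inflate β) (s :: (v ++ [t])) →
      List.IsChain (fun p q => segment ℝ p q ⊆ D.inflate (β + ε)) (s' :: (v.map f ++ [t])) := by
    intro v
    induction v with
    | nil =>
      intro s s' hs h
      simp only [List.nil_append, List.map_nil, List.isChain_pair] at h ⊢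
      exact segment_subset_inflate_add hβ h hs (by rwa [dist_self])
    | cons a v ih =>
      intro s s' hs h
      rw [List.cons_append, List.isChain_cons_cons] at h
      rw [List.map_cons, List.cons_append, List.isChain_cons_cons]
      exact ⟨segment_subset_inflate_add hβ h.1 hs (hf a), ih a (f a) (hf a) h.2⟩
  exact key v s s (by rwa [dist_self]) hv

/-- A minimum-link path of the inflation by `β` that is still minimal in the inflation by
`β + 2⁻ᵐ` can be rounded there. -/
theorem bitOpt_add_le {v : List Plane} {β L : ℝ} {m e : ℕ} (hβ : 0 ≤ β)
    (hv : v ∈ D.solutions s t β)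
    (hmin : ∀ v' ∈ D.solutions s t (β + (1 / 2) ^ m), links v ≤ links v')
    (hL : ∀ x ∈ D.inflate β, |x 0| ≤ L ∧ |x 1| ≤ L) (he : L ≤ 2 ^ e) :
    D.bitOpt s t (β + (1 / 2) ^ m) ≤ (2 * m + e + 4 : ℕ) := by
  have hplane : toPlane (v.map (roundPoint (m + 1))) = v.map fun p =>
      !₂[((roundPoint (m + 1) p).1 : ℝ), ((roundPoint (m + 1) p).2 : ℝ)] := by
    rw [toPlane, List.map_map]; rfl
  have hmem : toPlane (v.map (roundPoint (m + 1))) ∈ D.optimalSolutions s t (β + (1 / 2) ^ m) := by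
    rw [hplane]
    refine ⟨map_mem_solutions hβ (by positivity) hv fun p => ?_, fun v' hv' => ?_⟩
    -- One extra binary digit turns the rounding error `3/2 * 2⁻ᵐ` into `3/4 * 2⁻ᵐ`.
    · refine (dist_roundPoint_le (m + 1) p).trans ?_
      rw [pow_succ]
      have : (0 : ℝ) < (1 / 2) ^ m := by positivity
      linarith
    · have := hmin v' hv'
      simpa [links] using this
  refine (iInf₂_le (v.map (roundPoint (m + 1))) hmem).trans (Nat.cast_le.2 (inputBits_le ?_))
  intro p hp
  obtain ⟨q, hq, rfl⟩ := List.mem_map.1 hp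
  have hq' := hL q (mem_inflate_of_mem_solutions hv hq)
  have key : ∀ x : ℝ, |x| ≤ L →
      bitRat ((⌊x * 2 ^ (m + 1)⌋ : ℚ) / 2 ^ (m + 1)) ≤ 2 * m + e + 4 := by
    intro x hx
    have := bitRat_div_two_pow_le (m := m + 1) (abs_floor_mul_lt (m := m + 1) hx he) (by omega)
    omega
  exact ⟨key _ hq'.1, key _ hq'.2⟩

/-- For a fixed list of bends, being a solution is an upper set in `α` and being no longer than any
solution is a lower set. Both are order connected, hence measurable, and there are only countably
many rational lists. -/
theorem measurable_bitOpt : Measurable fun α => D.bitOpt s t α := by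
  have hset (v : List (ℚ × ℚ)) :
      MeasurableSet {α | toPlane v ∈ D.optimalSolutions s t α} := by
    have h1 : MeasurableSet {α | toPlane v ∈ D.solutions s t α} :=
      (IsUpperSet.ordConnected fun _ _ h hα => solutions_mono h hα).measurableSet
    have h2 : IsLowerSet {α | ∀ v' ∈ D.solutions s t α, links (toPlane v) ≤ links v'} :=
      fun _ _ h hα v' hv' => hα v' (solutions_mono h hv')
    exact h1.inter h2.ordConnected.measurableSet
  have hlt (c : ℕ∞) : MeasurableSet {α | D.bitOpt s t α < c} := by
    have : {α | D.bitOpt s t α < c} = ⋃ v : List (ℚ × ℚ), ⋃ _ : (inputBits v : ℕ∞) < c,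
        {α | toPlane v ∈ D.optimalSolutions s t α} := by
      ext α
      simp [bitOpt, iInf_lt_iff, and_comm]
    rw [this]
    exact MeasurableSet.iUnion fun v => MeasurableSet.iUnion fun _ => hset v
  refine ENat.measurable_iff.2 fun n => ?_
  have : (fun α => D.bitOpt s t α) ⁻¹' {(n : ℕ∞)} =
      {α | D.bitOpt s t α < (n : ℕ∞) + 1} \ {α | D.bitOpt s t α < n} := by
    ext α
    rw [mem_preimage, mem_singleton_iff, Set.mem_sdiff, mem_ofPred_eq, mem_ofPred_eq,
      ENat.lt_add_one_iff (ENat.natCast_ne_top n), not_lt, le_antisymm_iff]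
  rw [this]
  exact (hlt _).diff (hlt _)

/-- A path with rational bends is its own equivalent input. -/
theorem bitOptWith_le_bitOpt (A : Program) (w : ℕ) (α : ℝ) :
    D.bitOptWith A w s t α ≤ D.bitOpt s t α := by
  refine le_iInf₂ fun v hv => (iInf₂_le _ hv).trans ?_
  refine (iInf₂_le v (by simp [toPlane])).trans (iInf_le _ ⟨rfl, fun _ => rfl⟩)

/-! ### The number of links -/

/-- The number of links of a minimum-link path; `0` if there is no path. -/
noncomputable def minLinks (D : PolygonalDomain) (s t : Plane) (α : ℝ) : ℕ := sInf (links '' D.solutions s t α)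

theorem minLinks_le {α : ℝ} {v : List Plane} (hv : v ∈ D.solutions s t α) :
    D.minLinks s t α ≤ links v := Nat.sInf_le ⟨v, hv, rfl⟩

theorem exists_links_eq_minLinks {α : ℝ} (h : (D.solutions s t α).Nonempty) :
    ∃ v ∈ D.solutions s t α, links v = D.minLinks s t α := Nat.sInf_mem (h.image links)

theorem minLinks_anti {α β : ℝ} (h : (D.solutions s t α).Nonempty) (hαβ : α ≤ β) :
    D.minLinks s t β ≤ D.minLinks s t α := by
  obtain ⟨v, hv, hvα⟩ := exists_links_eq_minLinks h
  exact (minLinks_le (solutions_mono hαβ hv)).trans hvα.le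

/-- Hop between points of the region in grid cells of mesh `h = α / 4`. Each hop has length at most
`h + 2 * (3/2 * h) = α`, so its segment stays within `α` of the region, and no cell is used twice.
With `2M + 1 ≤ 11 L/α` cells per side the constant is `11² + 1`. -/
theorem exists_links_le {α L : ℝ} (hs : s ∈ D.region) (ht : t ∈ D.region) (hα : 0 < α)
    (hα1 : α ≤ L) (hL : ∀ x ∈ D.region, |x 0| ≤ L ∧ |x 1| ≤ L) :
    ∃ v ∈ D.solutions s t α, (links v : ℝ) ≤ 122 * (L / α) ^ 2 := by
  have : PreconnectedSpace D.region :=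
    isPreconnected_iff_preconnectedSpace.1 D.isConnected.isPreconnected
  set h := α / 4 with hh
  have hh0 : 0 < h := by positivity
  set M := ⌈L / h⌉₊ with hM
  set F : Finset (ℤ × ℤ) := Finset.Icc (-(M : ℤ)) M ×ˢ Finset.Icc (-(M : ℤ)) M with hF
  let c : D.region → F := fun p => ⟨cell h p, Finset.mem_product.2
    ⟨floor_div_mem_Icc hh0 (hL p p.2).1, floor_div_mem_Icc hh0 (hL p p.2).2⟩⟩
  obtain ⟨v, hvl, hv⟩ := exists_isChain_dist_le c hh0 (r := 3 / 2 * h) (by positivity)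
    (fun p q hpq => dist_le_of_cell_eq hh0 (congrArg Subtype.val hpq)) ⟨s, hs⟩ ⟨t, ht⟩
  refine ⟨v.map Subtype.val, ?_, ?_⟩
  · have h1 : List.IsChain (fun p q => segment ℝ p q ⊆ D.inflate α)
        (((⟨s, hs⟩ : D.region) :: (v ++ [⟨t, ht⟩])).map Subtype.val) := by
      rw [List.isChain_map]
      refine hv.imp fun p q hpq x hx => mem_inflate_of_dist_le p.2 ?_
      have h2 : dist x p ≤ dist (p : Plane) q := by
        rw [dist_comm]
        have := (mem_segment_iff_wbtw.1 hx).dist_add_dist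
        linarith [dist_nonneg (x := x) (y := (q : Plane))]
      refine h2.trans (hpq.trans ?_)
      rw [hh]; linarith
    rwa [List.map_cons, List.map_append] at h1
  · have hcard : Fintype.card F = (2 * M + 1) ^ 2 := by
      rw [Fintype.card_coe, hF, Finset.card_product, Int.card_Icc]
      have : ((M : ℤ) + 1 - -(M : ℤ)).toNat = 2 * M + 1 := by omega
      rw [this, sq]
    rw [hcard] at hvl
    have hlinks : (links (v.map Subtype.val) : ℝ) ≤ (2 * M + 1) ^ 2 + 1 := by
      rw [links, List.length_map]
      exact_mod_cast Nat.succ_le_succ hvl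
    have h1 : 1 ≤ L / α := (one_le_div hα).2 hα1
    have hMle : (M : ℝ) ≤ 5 * (L / α) := by
      have h2 : (M : ℝ) < L / h + 1 := Nat.ceil_lt_add_one (div_nonneg (hα.le.trans hα1) hh0.le)
      have h3 : L / h = 4 * (L / α) := by rw [hh]; field_simp
      linarith
    have h2 : (2 * (M : ℝ) + 1) ^ 2 ≤ (11 * (L / α)) ^ 2 := by
      gcongr
      linarith
    nlinarith

end PolygonalDomain
end MinLink

/-! ### Drops of antitone functions, and expectations from tails -/

namespace MinLink

open Set Filter MeasureTheory

/-- An antitone function with natural values rarely drops over a short distance. -/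
theorem volume_drop_le {k : ℝ → ℕ} (hk : Antitone k) {a b ε : ℝ} (hε : 0 ≤ ε) (hab : a ≤ b) :
    volume {x ∈ Ioc a b | k x < k (x - ε)} ≤ ENNReal.ofReal (ε * k (a - ε)) := by
  set g : ℝ → ℝ≥0∞ := fun x => (k x : ℝ≥0∞) with hg
  have hkm : Measurable k := hk.measurable
  have hgm : Measurable g := (measurable_of_countable _).comp hkm
  set S := {x | k x < k (x - ε)} with hS
  have hSm : MeasurableSet S := measurableSet_lt hkm (hkm.comp (measurable_id.sub_const ε))
  have hset : {x ∈ Ioc a b | k x < k (x - ε)} = S ∩ Ioc a b := by ext; simp [hS, and_comm]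
  have hfin : ∫⁻ x in Ioc a b, g x ≠ ∞ := by
    refine ((setLIntegral_mono measurable_const fun x hx =>
      (Nat.cast_le.2 (hk hx.1.le) : g x ≤ g a)).trans_lt ?_).ne
    rw [setLIntegral_const, Real.volume_Ioc]
    exact ENNReal.mul_lt_top (ENNReal.natCast_lt_top _) ENNReal.ofReal_lt_top
  have hshift : ∫⁻ x in Ioc a b, g (x - ε) = ∫⁻ x in Ioc (a - ε) (b - ε), g x := by
    rw [← (measurePreserving_sub_right volume ε).setLIntegral_comp_preimage measurableSet_Ioc hgm,
      preimage_sub_const_Ioc, sub_add_cancel, sub_add_cancel]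
  -- Values are integers, so a drop costs at least `1`. After translation the two integrals differ
  -- by at most the integral over `Ioc (a - ε) a`, and `hfin` permits the cancellation.
  have h1 : volume (S ∩ Ioc a b) + ∫⁻ x in Ioc a b, g x ≤ ∫⁻ x in Ioc a b, g (x - ε) := by
    rw [← Measure.restrict_apply hSm, ← lintegral_indicator_one hSm, ← lintegral_add_right _ hgm]
    refine lintegral_mono fun x => ?_
    by_cases hx : x ∈ S
    · rw [indicator_of_mem hx, Pi.one_apply, add_comm]
      have hx' : k x + 1 ≤ k (x - ε) := hx
      exact (Nat.cast_succ (k x)).symm.trans_le (Nat.cast_le.2 hx')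
    · rw [indicator_of_notMem hx, zero_add]
      exact Nat.cast_le.2 (hk (by linarith))
  have h2 : ∫⁻ x in Ioc (a - ε) (b - ε), g x ≤
      ENNReal.ofReal (ε * k (a - ε)) + ∫⁻ x in Ioc a b, g x := by
    calc _ ≤ ∫⁻ x in Ioc (a - ε) a ∪ Ioc a b, g x := by
          refine lintegral_mono_set ?_
          rw [Ioc_union_Ioc_eq_Ioc (by linarith) hab]
          exact Ioc_subset_Ioc_right (by linarith)
      _ ≤ (∫⁻ x in Ioc (a - ε) a, g x) + ∫⁻ x in Ioc a b, g x := lintegral_union_le g _ _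
      _ ≤ _ := by
          refine add_le_add_left ?_ _
          refine (setLIntegral_mono measurable_const fun x hx =>
            (Nat.cast_le.2 (hk hx.1.le) : g x ≤ g (a - ε))).trans ?_
          rw [setLIntegral_const, Real.volume_Ioc, sub_sub_cancel, ENNReal.ofReal_mul hε,
            ENNReal.ofReal_natCast, mul_comm]
  rw [hset]
  exact (ENNReal.add_le_add_iff_right hfin).1 (h1.trans (hshift.trans_le h2))

/-- Layer-cake bound with layers of height `6`, the number of bits gained when `i` grows by one in
`volume_lt_bitOpt_le`. -/
theorem toENNReal_le_add_tsum (x : ℕ∞) (b : ℕ) :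
    (x : ℝ≥0∞) ≤ b + ∑' i : ℕ, {y : ℕ∞ | ((b + 6 * i : ℕ) : ℕ∞) < y}.indicator (fun _ => 6) x := by
  induction x using ENat.recTopCoe with
  | top =>
    have : ∀ i : ℕ, {y : ℕ∞ | ((b + 6 * i : ℕ) : ℕ∞) < y}.indicator (fun _ => (6 : ℝ≥0∞)) ⊤ = 6 :=
      by
      intro i
      have : (⊤ : ℕ∞) ∈ {y : ℕ∞ | ((b + 6 * i : ℕ) : ℕ∞) < y} := ENat.natCast_lt_top _
      exact indicator_of_mem this _
    simp_rw [this]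
    rw [ENNReal.tsum_const_eq_top_of_ne_zero (by norm_num)]
    simp
  | coe n =>
    have h := ENNReal.sum_le_tsum (f := fun i : ℕ =>
      {y : ℕ∞ | ((b + 6 * i : ℕ) : ℕ∞) < y}.indicator (fun _ => (6 : ℝ≥0∞)) n)
      (Finset.range ((n - b + 5) / 6))
    have hmem : ∀ i ∈ Finset.range ((n - b + 5) / 6),
        (n : ℕ∞) ∈ {y : ℕ∞ | ((b + 6 * i : ℕ) : ℕ∞) < y} := by
      intro i hi
      rw [Finset.mem_range] at hi
      rw [mem_ofPred_eq]
      exact Nat.cast_lt.2 (by omega : b + 6 * i < n)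
    rw [Finset.sum_congr rfl fun i hi => indicator_of_mem (hmem i hi) _, Finset.sum_const, Finset.card_range] at h
    refine le_trans ?_ (add_le_add_right h _)
    rw [ENat.toENNReal_coe, nsmul_eq_mul]
    have hn : n ≤ b + (n - b + 5) / 6 * 6 := by omega
    have hn' : (n : ℝ≥0∞) ≤ ((b + (n - b + 5) / 6 * 6 : ℕ) : ℝ≥0∞) := Nat.cast_le.2 hn
    rwa [Nat.cast_add, Nat.cast_mul, Nat.cast_ofNat] at hn'

/-- The expectation of a function whose tails decay exponentially. -/
theorem lintegral_le_of_tail {Ω : Type*} [MeasurableSpace Ω] {μ : Measure Ω} [IsProbabilityMeasure μ]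
    {f : Ω → ℕ∞} (hf : Measurable f) {b : ℕ} {c : ℝ≥0∞}
    (htail : ∀ i : ℕ, μ {x | ((b + 6 * i : ℕ) : ℕ∞) < f x} ≤ c * (2⁻¹) ^ i) :
    ∫⁻ x, (f x : ℝ≥0∞) ∂μ ≤ b + 12 * c := by
  have hms : ∀ i : ℕ, MeasurableSet {y : ℕ∞ | ((b + 6 * i : ℕ) : ℕ∞) < y} :=
    fun i => MeasurableSet.of_discrete
  have hm : ∀ i : ℕ, Measurable fun x =>
      {y : ℕ∞ | ((b + 6 * i : ℕ) : ℕ∞) < y}.indicator (fun _ => (6 : ℝ≥0∞)) (f x) :=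
    fun i => (measurable_const.indicator (hms i)).comp hf
  calc ∫⁻ x, (f x : ℝ≥0∞) ∂μ
      ≤ ∫⁻ x, (b + ∑' i : ℕ,
          {y : ℕ∞ | ((b + 6 * i : ℕ) : ℕ∞) < y}.indicator (fun _ => (6 : ℝ≥0∞)) (f x)) ∂μ :=
        lintegral_mono fun x => toENNReal_le_add_tsum (f x) b
    _ = b + ∑' i : ℕ, 6 * μ {x | ((b + 6 * i : ℕ) : ℕ∞) < f x} := by
        rw [lintegral_add_left measurable_const, lintegral_const, measure_univ, mul_one,
          lintegral_tsum fun i => (hm i).aemeasurable]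
        congr 2
        ext i
        exact lintegral_indicator_const_comp hf (hms i) 6
    _ ≤ b + ∑' i : ℕ, 6 * (c * (2⁻¹) ^ i) := by
        gcongr with i
        exact htail i
    _ = b + 12 * c := by
        rw [ENNReal.tsum_mul_left, ENNReal.tsum_mul_left, ENNReal.tsum_geometric,
          ENNReal.one_sub_inv_two, inv_inv]
        ring

/-! ### Tail and expectation of the bit length -/

namespace PolygonalDomain

variable {D : PolygonalDomain} {s t : Plane}

theorem three_le_numVertices (D : PolygonalDomain) : 3 ≤ D.numVertices := by
  have hne : (frontier D.region).Nonempty := by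
    refine nonempty_frontier_iff.2 ⟨D.isConnected.nonempty, fun h => ?_⟩
    exact noncompact_univ Plane (h ▸ D.isCompact)
  obtain ⟨f, hf⟩ := hne
  obtain ⟨_, _, ⟨j, _⟩, _⟩ := mem_frontier_iff.1 hf
  exact (D.simple j).1.trans (Finset.single_le_sum (f := D.size) (fun _ _ => Nat.zero_le _)
    (Finset.mem_univ j))

theorem volume_lt_bitOpt_le {δ L : ℝ} (hs : s ∈ D.region) (ht : t ∈ D.region) (hδ : 0 < δ)
    (hδL : δ ≤ L) (hL1 : 1 ≤ L) (hL : ∀ x ∈ D.inflate δ, |x 0| ≤ L ∧ |x 1| ≤ L) {b : ℕ}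
    (hb : 2 * (L / δ) ^ 3 ≤ 2 ^ b) (hbL : L ≤ 2 ^ b) (i : ℕ) :
    volume (Icc 0 δ ∩ {α | ((3 * b + 4 + 6 * i : ℕ) : ℕ∞) < D.bitOpt s t α}) ≤
      ENNReal.ofReal (δ * (245 * (1 / 2) ^ i)) := by
  set r : ℝ := (1 / 2) ^ i with hr
  have hr0 : 0 < r := by positivity
  have hr1 : r ≤ 1 := pow_le_one₀ (by norm_num) (by norm_num)
  set a : ℝ := δ * r with ha
  have ha0 : 0 < a := by positivity
  have haδ : a ≤ δ := by nlinarith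
  -- The drop set has measure `O(ε (L/a)²)`, which must be `O(a)`; hence `ε` is of order `a³`, and
  -- three binary digits are needed per step of `i`. The bit bound is then `2 * (b + 3 * i) + b +
  -- 4`.
  set ε : ℝ := (1 / 2) ^ (b + 3 * i) with hε
  have hε0 : 0 < ε := by positivity
  have hεr : ε = (2 ^ b)⁻¹ * r ^ 3 := by
    rw [hε, hr, pow_add, ← pow_mul, mul_comm i 3, one_div_pow, one_div]
  have hεL : ε * (2 * L ^ 3) ≤ a ^ 3 := by
    have h1 : 2 * L ^ 3 ≤ 2 ^ b * δ ^ 3 := by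
      rw [div_pow, mul_div_assoc', div_le_iff₀ (by positivity)] at hb
      exact hb
    rw [hεr, ha]
    calc (2 ^ b)⁻¹ * r ^ 3 * (2 * L ^ 3) ≤ (2 ^ b)⁻¹ * r ^ 3 * (2 ^ b * δ ^ 3) := by gcongr
      _ = (δ * r) ^ 3 := by field_simp
  have hεa : ε ≤ a / 2 := by
    have h2 : a ^ 3 ≤ a * L ^ 3 := by
      have : a ^ 2 ≤ L ^ 3 := by
        calc a ^ 2 ≤ L ^ 2 := by gcongr; linarith
          _ ≤ L ^ 3 := pow_le_pow_right₀ hL1 (by norm_num)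
      nlinarith
    have hL3 : 0 < L ^ 3 := by positivity
    nlinarith
  have hregion : ∀ x ∈ D.region, |x 0| ≤ L ∧ |x 1| ≤ L := fun x hx => hL x (Or.inl (Or.inl hx))
  have hne : ∀ α : ℝ, 0 < α → (D.solutions s t α).Nonempty := by
    intro α hα
    obtain ⟨v, hv, -⟩ := exists_links_le (α := min α L) hs ht (lt_min hα (by linarith))
      (min_le_right _ _) hregion
    exact ⟨v, solutions_mono (min_le_left _ _) hv⟩
  -- Solutions are known to exist only for positive inflation, and `minLinks` is `0` on an empty
  -- solution set, which could break antitonicity. The clamp is inactive where it matters: `α > a`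
  -- and `ε ≤ a / 2`.
  set k : ℝ → ℕ := fun x => D.minLinks s t (max x (a / 2)) with hk
  have hkanti : Antitone k := fun x y hxy =>
    minLinks_anti (hne _ (lt_max_of_lt_right (by positivity))) (max_le_max_right _ hxy)
  have hsub : Icc 0 δ ∩ {α | ((3 * b + 4 + 6 * i : ℕ) : ℕ∞) < D.bitOpt s t α} ⊆
      Icc 0 a ∪ {x ∈ Ioc a δ | k x < k (x - ε)} := by
    rintro α ⟨⟨hα0, hαδ⟩, hα⟩
    by_cases hαa : α ≤ a
    · exact Or.inl ⟨hα0, hαa⟩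
    push Not at hαa
    refine Or.inr ⟨⟨hαa, hαδ⟩, ?_⟩
    by_contra hle
    obtain ⟨v, hv, hvk⟩ := exists_links_eq_minLinks (hne (α - ε) (by linarith))
    have hkα : k α = D.minLinks s t α := by rw [hk]; simp only; rw [max_eq_left (by linarith)]
    have hkε : k (α - ε) = D.minLinks s t (α - ε) := by
      rw [hk]; simp only; rw [max_eq_left (by linarith)]
    have hαε : α - ε + (1 / 2) ^ (b + 3 * i) = α := by rw [← hε]; ring
    have h1 := bitOpt_add_le (m := b + 3 * i) (e := b) (by linarith : 0 ≤ α - ε) hv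
      (fun v' hv' => by
        rw [hαε] at hv'
        have := minLinks_le hv'
        omega) (fun x hx => hL x (inflate_mono (by linarith) hx)) hbL
    rw [hαε] at h1
    refine absurd (hα.trans_le h1) (not_lt.2 (Nat.cast_le.2 (by omega)))
  have hkbound : (k (a - ε) : ℝ) ≤ 488 * (L / a) ^ 2 := by
    obtain ⟨v, hv, hvl⟩ := exists_links_le (α := a / 2) hs ht (by positivity) (by linarith) hregion
    have h1 : k (a - ε) ≤ links v :=
      minLinks_le (solutions_mono (le_max_right _ _) hv)
    calc (k (a - ε) : ℝ) ≤ links v := Nat.cast_le.2 h1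
      _ ≤ 122 * (L / (a / 2)) ^ 2 := hvl
      _ = 488 * (L / a) ^ 2 := by field_simp; norm_num
  have hprod : ε * k (a - ε) ≤ 244 * a := by
    have h1 : 0 < L := by linarith
    calc ε * k (a - ε) ≤ ε * (488 * (L / a) ^ 2) := by gcongr
      _ = 244 * (ε * (2 * L ^ 3)) / (L * a ^ 2) := by field_simp; norm_num
      _ ≤ 244 * a ^ 3 / (L * a ^ 2) := by gcongr
      _ = 244 * a / L := by field_simp
      _ ≤ 244 * a := div_le_self (by positivity) hL1
  calc _ ≤ volume (Icc 0 a ∪ {x ∈ Ioc a δ | k x < k (x - ε)}) := measure_mono hsub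
    _ ≤ volume (Icc 0 a) + volume {x ∈ Ioc a δ | k x < k (x - ε)} := measure_union_le _ _
    _ ≤ ENNReal.ofReal a + ENNReal.ofReal (ε * k (a - ε)) := by
        refine add_le_add ?_ (volume_drop_le hkanti hε0.le haδ)
        rw [Real.volume_Icc, sub_zero]
    _ = ENNReal.ofReal (a + ε * k (a - ε)) := (ENNReal.ofReal_add ha0.le (by positivity)).symm
    _ ≤ _ := ENNReal.ofReal_le_ofReal (by rw [ha] at *; linarith)

theorem expectedCost_bitOpt_le {δ L : ℝ} (hs : s ∈ D.region) (ht : t ∈ D.region) (hδ : 0 < δ)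
    (hδL : δ ≤ L) (hL1 : 1 ≤ L) (hL : ∀ x ∈ D.inflate δ, |x 0| ≤ L ∧ |x 1| ≤ L) {b : ℕ}
    (hb : 2 * (L / δ) ^ 3 ≤ 2 ^ b) (hbL : L ≤ 2 ^ b) :
    expectedCost δ (fun α => D.bitOpt s t α) ≤ (3 * b + 2944 : ℕ) := by
  have hvol : volume (Icc 0 δ) = ENNReal.ofReal δ := by rw [Real.volume_Icc, sub_zero]
  have hv0 : volume (Icc 0 δ) ≠ 0 := by rw [hvol]; simpa using hδ
  have hvt : volume (Icc 0 δ) ≠ ∞ := by rw [hvol]; exact ENNReal.ofReal_ne_top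
  have : IsProbabilityMeasure (ProbabilityTheory.cond volume (Icc 0 δ)) :=
    ProbabilityTheory.cond_isProbabilityMeasure_of_finite hv0 hvt
  -- `245 = 1 + 244`: the discarded interval and the drop set. The total is `3 * b + 4 + 12 * 245`.
  refine (lintegral_le_of_tail (b := 3 * b + 4) (c := 245) measurable_bitOpt fun i => ?_).trans ?_
  · rw [ProbabilityTheory.cond_apply measurableSet_Icc]
    have h1 := volume_lt_bitOpt_le hs ht hδ hδL hL1 hL hb hbL i
    rw [ENNReal.ofReal_mul hδ.le, ← hvol] at h1
    rw [mul_comm, ← div_eq_mul_inv]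
    refine ENNReal.div_le_of_le_mul' (h1.trans_eq ?_)
    congr 1
    rw [ENNReal.ofReal_mul (by norm_num), ENNReal.ofReal_pow (by norm_num), one_div,
      ENNReal.ofReal_inv_of_pos (by norm_num)]
    norm_num
  · norm_cast

end PolygonalDomain
end MinLink

theorem mainTheorem9 :
    ∃ C : ℝ, 0 < C ∧
      ∀ (D : MinLink.PolygonalDomain) (s t : MinLink.Plane) (δ L : ℝ),
        s ∈ D.region → t ∈ D.region → 0 < δ → δ ≤ 1 → 1 ≤ L →
        (∀ x ∈ D.inflate δ, |x 0| ≤ L ∧ |x 1| ≤ L) →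
        Measurable (fun α => D.bitOpt s t α) ∧
        MinLink.expectedCost δ (fun α => D.bitOpt s t α) ≤
          ENNReal.ofReal (C * Real.log (D.numVertices * L / δ)) ∧
        ∀ (A : MinLink.Program) (w : ℕ),
          MinLink.expectedCost δ (fun α => D.bitOptWith A w s t α) ≤
            ENNReal.ofReal (C * Real.log (D.numVertices * L / δ)) := by
  -- Below, `b < 2 + 6 log (L/δ)`, so `3 * b + 2944 ≤ 2950 + 18 log (L/δ)`, and `1 ≤ log n` absorbs
  -- the constant.
  refine ⟨3000, by norm_num, fun D s t δ L hs ht hδ hδ1 hL1 hL => ?_⟩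
  have hq1 : 1 ≤ L / δ := (one_le_div hδ).2 (hδ1.trans hL1)
  have hq0 : 0 < L / δ := by linarith
  have hL0 : 0 < L := by linarith
  set b := ⌈Real.logb 2 (2 * (L / δ) ^ 3)⌉₊ with hb
  have hb1 : 2 * (L / δ) ^ 3 ≤ 2 ^ b := by
    rw [← Real.rpow_natCast 2 b]
    exact (Real.logb_le_iff_le_rpow (by norm_num) (by positivity)).1 (Nat.le_ceil _)
  have hbL : L ≤ 2 ^ b := by
    have h1 : L ≤ L / δ := by rw [le_div_iff₀ hδ]; nlinarith
    have h2 : L / δ ≤ (L / δ) ^ 3 := le_self_pow₀ hq1 (by norm_num)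
    linarith
  have hmain := MinLink.PolygonalDomain.expectedCost_bitOpt_le hs ht hδ (hδ1.trans hL1) hL1 hL
    hb1 hbL
  have hfinal : MinLink.expectedCost δ (fun α => D.bitOpt s t α) ≤
      ENNReal.ofReal (3000 * Real.log (D.numVertices * L / δ)) := by
    refine hmain.trans ?_
    rw [← ENNReal.ofReal_natCast]
    refine ENNReal.ofReal_le_ofReal ?_
    have hn : (3 : ℝ) ≤ D.numVertices := by exact_mod_cast D.three_le_numVertices
    have hlog3 : 1 ≤ Real.log D.numVertices := by
      rw [Real.le_log_iff_exp_le (by linarith)]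
      linarith [Real.exp_one_lt_d9]
    have hlogq : 0 ≤ Real.log (L / δ) := Real.log_nonneg hq1
    have hsplit : Real.log (D.numVertices * L / δ) = Real.log D.numVertices + Real.log (L / δ) := by
      rw [mul_div_assoc, Real.log_mul (by positivity) hq0.ne']
    have hlog2 : 0 < Real.log 2 := Real.log_pos (by norm_num)
    have hlogb : Real.logb 2 (2 * (L / δ) ^ 3) = 1 + 3 * (Real.log (L / δ) / Real.log 2) := by
      rw [Real.logb, Real.log_mul (by norm_num) (by positivity), Real.log_pow]
      field_simp
      push_cast
      ring
    have hb2 : (b : ℝ) < Real.logb 2 (2 * (L / δ) ^ 3) + 1 := by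
      refine Nat.ceil_lt_add_one ?_
      rw [hlogb]
      positivity
    have hdiv : Real.log (L / δ) / Real.log 2 ≤ 2 * Real.log (L / δ) := by
      rw [div_le_iff₀ hlog2]
      nlinarith [Real.log_two_gt_d9]
    rw [hlogb] at hb2
    rw [hsplit]
    push_cast
    linarith
  refine ⟨MinLink.PolygonalDomain.measurable_bitOpt, hfinal, fun A w => le_trans ?_ hfinal⟩
  exact MeasureTheory.lintegral_mono fun α => ENat.toENNReal_le.2
    (MinLink.PolygonalDomain.bitOptWith_le_bitOpt A w α)
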